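/- **Definitions.** A lattice $L$ is *order polynomially complete* (o.p.c.) if for every $n$, every monotone function $L^n\to L$ is induced by a lattice-theoretic polynomial, i.e. by an expression built from the $n$ variables and constants from $L$ with $\vee$ and $\wedge$. A subset $A$ of a partial order $L$ is *uniform* if it is an antichain, a well-ordered chain, or a co-well-ordered chain (a chain well-ordered by $\ge$). Let $\mu(L)$ be the smallest cardinal $\mu$ such that $L$ has no uniform subset of cardinality $\mu$, and let $\mu_\infty(L)=\sup_{n\ge 1}\mu(L^n)$, where $L^n$ is ordered coordinatewise. For $n\ge 1$ let $\nu_n(L)$ be the smallest cardinal $\nu$ such that there is no family of $\nu$ many pairwise incomparable monotone functions from $L^n$ to $L$ (functions are ordered pointwise). A cardinal is (strongly) *inaccessible* if it is uncountable, regular and a strong limit. **Theorem.** 1. If $L$ is an infinite o.p.c. lattice, then $\mu(L)=|L|$, and this cardinal is inaccessible. 2. More generally, let $L$ be an infinite bounded partial order such that for every $n\ge 1$ and every cardinal $\kappa$ of uncountable cofinality, $\kappa<\nu_n(L)$ implies $\kappa<\mu_\infty(L)$. Then $\mu(L)=|L|$, and this cardinal is inaccessible. 3. In particular, if there is no inaccessible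 cardinal, then there is no infinite o.p.c. lattice. -/

import Mathlib

open Cardinal

universe u

/-- Lattice-theoretic polynomials over `L` in the `n` variables `x₀, …, xₙ₋₁`: expressions built
from the variables and constants from `L` with the two lattice operations. -/
inductive LatticePolynomial (L : Type u) (n : ℕ) : Type u
  | var (i : Fin n) : LatticePolynomial L n
  | const (a : L) : LatticePolynomial L n
  | sup (p q : LatticePolynomial L n) : LatticePolynomial L n
  | inf (p q : LatticePolynomial L n) : LatticePolynomial L n

/-- The `n`-ary function on `L` induced by a lattice polynomial. -/
def LatticePolynomial.eval {L : Type u} [Lattice L] {n : ℕ} :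
    LatticePolynomial L n → (Fin n → L) → L
  | .var i, x => x i
  | .const a, _ => a
  | .sup p q, x => p.eval x ⊔ q.eval x
  | .inf p q, x => p.eval x ⊓ q.eval x

/-- `L` is `n`-order polynomially complete: every monotone `n`-ary function on `L` is a polynomial
function. -/
def IsNOrderPolynomiallyComplete (n : ℕ) (L : Type u) [Lattice L] : Prop :=
  ∀ f : (Fin n → L) → L, Monotone f → ∃ p : LatticePolynomial L n, ∀ x, f x = p.eval x

/-- `L` is order polynomially complete (o.p.c.). -/
def IsOrderPolynomiallyComplete (L : Type u) [Lattice L] : Prop :=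
  ∀ n : ℕ, IsNOrderPolynomiallyComplete n L

/-- A subset of a partial order is uniform if it is an antichain, a well-ordered chain, or a
co-well-ordered chain. -/
def IsUniformSubset {L : Type u} [PartialOrder L] (A : Set L) : Prop :=
  IsAntichain (· ≤ ·) A ∨
    IsWellOrder A (fun a b => (a : L) < (b : L)) ∨
    IsWellOrder A (fun a b => (b : L) < (a : L))

/-- `μ(L)`: the least cardinal `c` such that `L` has no uniform subset of cardinality `c`. -/
noncomputable def muCard (L : Type u) [PartialOrder L] : Cardinal.{u} :=
  sInf {c : Cardinal.{u} | ¬ ∃ A : Set L, IsUniformSubset A ∧ #A = c}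

/-- `μ_∞(L)`: the supremum of `μ(Lⁿ)` over all `n ≥ 1`, where `Lⁿ` is ordered coordinatewise. -/
noncomputable def muInfCard (L : Type u) [PartialOrder L] : Cardinal.{u} :=
  ⨆ n : ℕ, muCard (Fin (n + 1) → L)

/-- `ν(L₁, L₂)`: the least cardinal `c` such that there is no family of `c` many pairwise
incomparable monotone functions from `L₁` to `L₂`; functions are ordered pointwise. -/
noncomputable def nuCard (L₁ L₂ : Type u) [PartialOrder L₁] [PartialOrder L₂] : Cardinal.{u} :=
  sInf {c : Cardinal.{u} | ¬ ∃ F : Set (L₁ →o L₂), IsAntichain (· ≤ ·) F ∧ #F = c}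

/-- For every `n ≥ 1` and every cardinal `κ` of uncountable cofinality, `κ < ν_n(L)` implies
`κ < μ_∞(L)`, where `ν_n(L) = ν(Lⁿ, L)`. -/
def NuBoundedByMu (L : Type u) [PartialOrder L] : Prop :=
  ∀ (n : ℕ) (κ : Cardinal.{u}), ℵ₀ < κ.ord.cof →
    κ < nuCard (Fin (n + 1) → L) L → κ < muInfCard L

/-! Part 1 reduces to part 2. A polynomial is one of countably many shapes evaluated at finitely
many constants, and is monotone in those constants. Hence an antichain of polynomial functions of
size `κ`, with `κ` of uncountable cofinality, gives an antichain of `κ` constant tuples in a finite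
power of `L`. Bounds of `L` come from the estimate `p x ≤ x ⊔ c` for unary polynomials, and its
dual.

For part 2, a uniform family of infinite size `c` in a power of `L` codes the subsets of `c` by
monotone maps. Pairing each subset with its complement gives `2 ^ c` incomparable functions, so
`μ_∞(L)` is a strong limit. Counting the powers of `L`, together with Erdős–Rado, yields `μ_∞(L) =
|L| = μ(L)`; in particular no uniform subset of `L` has size `|L|`.

Suppose `|L|` is singular. If its cofinality is uncountable, cofinally many antichains of functions
glue to one of size `|L|`, which the hypothesis forbids. If it is `ℵ₀`, an infinite antichain in a
finite power of `L` would let countably many antichains vary independently, giving `2 ^ |L|`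
incomparable functions. So neither `L` nor `L × L` has an infinite antichain, and `L` or its dual is
a well-quasi-order. There, well-ordered chains of regular lengths approaching `|L|` can be stacked
into a uniform chain of size `|L|`, a contradiction. -/

/-- A family of pairwise incomparable elements of `P` indexed by `I`. -/
def HasAntichainFamily (P : Type*) [LE P] (I : Type*) : Prop :=
  ∃ f : I → P, ∀ i j, f i ≤ f j → i = j

theorem HasAntichainFamily.map {P Q I : Type*} [Preorder P] [Preorder Q] (h : HasAntichainFamily P I)
    (e : P ↪o Q) : HasAntichainFamily Q I := by
  obtain ⟨f, hf⟩ := h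
  exact ⟨e ∘ f, fun i j hij => hf i j (e.le_iff_le.1 hij)⟩

theorem HasAntichainFamily.comap {P I J : Type*} [LE P] (h : HasAntichainFamily P I)
    (e : J ↪ I) : HasAntichainFamily P J := by
  obtain ⟨f, hf⟩ := h
  exact ⟨f ∘ e, fun i j hij => e.injective (hf _ _ hij)⟩

theorem HasAntichainFamily.exists_set {P I : Type u} [PartialOrder P]
    (h : HasAntichainFamily P I) : ∃ A : Set P, IsAntichain (· ≤ ·) A ∧ #A = #I := by
  obtain ⟨f, hf⟩ := h
  refine ⟨Set.range f, ?_, mk_range_eq f fun i j hij => hf i j hij.le⟩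
  rintro _ ⟨i, rfl⟩ _ ⟨j, rfl⟩ hne hle
  exact hne (congrArg f (hf i j hle))

theorem HasAntichainFamily.sigma {P Q I : Type*} [Preorder P] [Preorder Q] {J : I → Type*}
    (h : HasAntichainFamily P I) (hJ : ∀ i, HasAntichainFamily Q (J i)) :
    HasAntichainFamily (P × Q) (Σ i, J i) := by
  obtain ⟨f, hf⟩ := h
  choose g hg using hJ
  refine ⟨fun x => (f x.1, g x.1 x.2), ?_⟩
  rintro ⟨i, x⟩ ⟨j, y⟩ hle
  obtain rfl : i = j := hf _ _ hle.1
  obtain rfl : x = y := hg _ _ _ hle.2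
  rfl

theorem HasAntichainFamily.pi {Q I : Type*} [Preorder Q] {J : I → Type*}
    (hJ : ∀ i, HasAntichainFamily Q (J i)) : HasAntichainFamily (I → Q) (∀ i, J i) := by
  choose g hg using hJ
  exact ⟨fun x i => g i (x i), fun x y hle => funext fun i => hg i _ _ (hle i)⟩

/-- A power set embeds in the square of itself as an antichain. -/
theorem hasAntichainFamily_prod_of_embedding {Q I : Type*} [Preorder Q] (e : Set I ↪o Q) :
    HasAntichainFamily (Q × Q) (Set I) :=
  ⟨fun S => (e S, e Sᶜ), fun _ _ h => le_antisymm (e.le_iff_le.1 h.1)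
    (Set.compl_subset_compl.1 (e.le_iff_le.1 h.2))⟩

/-! ### Uniform families and the cardinals `μ`, `μ_∞`, `ν`. -/

/-- A family that is strictly increasing, strictly decreasing or pairwise incomparable. -/
def IsUniformFamily {I P : Type*} [LinearOrder I] [PartialOrder P] (f : I → P) : Prop :=
  StrictMono f ∨ StrictAnti f ∨ ∀ i j, f i ≤ f j → i = j

theorem IsUniformFamily.injective {I P : Type*} [LinearOrder I] [PartialOrder P] {f : I → P}
    (h : IsUniformFamily f) : Function.Injective f := by
  rcases h with h | h | h
  · exact h.injective
  · exact h.injective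
  · exact fun i j hij => h i j hij.le

theorem IsUniformFamily.comp {I J P : Type*} [LinearOrder I] [LinearOrder J] [PartialOrder P]
    {f : I → P} (h : IsUniformFamily f) {g : J → I} (hg : StrictMono g) :
    IsUniformFamily (f ∘ g) := by
  rcases h with h | h | h
  · exact Or.inl (h.comp hg)
  · exact Or.inr (Or.inl (h.comp_strictMono hg))
  · exact Or.inr (Or.inr fun i j hij => hg.injective (h _ _ hij))

/-- `P` has a uniform subset of cardinality `c`. -/
def HasUniform (P : Type u) [PartialOrder P] (c : Cardinal.{u}) : Prop :=
  ∃ A : Set P, IsUniformSubset A ∧ #A = c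

theorem IsUniformFamily.isUniformSubset_range {I P : Type u} [LinearOrder I] [WellFoundedLT I]
    [PartialOrder P] {f : I → P} (h : IsUniformFamily f) : IsUniformSubset (Set.range f) := by
  have hinj := h.injective
  let e := (Equiv.ofInjective f hinj).symm
  have he : ∀ a, f (e a) = a := fun a => congrArg Subtype.val ((Equiv.ofInjective f hinj).apply_symm_apply a)
  rcases h with h | h | h
  · refine Or.inr (Or.inl ?_)
    refine RelEmbedding.isWellOrder (s := ((· < ·) : I → I → Prop)) ⟨e.toEmbedding, ?_⟩
    intro a b
    rw [← he a, ← he b]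
    exact h.lt_iff_lt.symm
  · refine Or.inr (Or.inr ?_)
    refine RelEmbedding.isWellOrder (s := ((· < ·) : I → I → Prop)) ⟨e.toEmbedding, ?_⟩
    intro a b
    rw [← he a, ← he b]
    exact h.lt_iff_gt.symm
  · refine Or.inl ?_
    rintro _ ⟨i, rfl⟩ _ ⟨j, rfl⟩ hne hle
    exact hne (congrArg f (h i j hle))

theorem IsUniformFamily.hasUniform {I P : Type u} [LinearOrder I] [WellFoundedLT I]
    [PartialOrder P] {f : I → P} (h : IsUniformFamily f) {c : Cardinal.{u}} (hc : c ≤ #I) :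
    HasUniform P c := by
  obtain ⟨s, rfl⟩ := le_mk_iff_exists_set.1 hc
  have hs : IsUniformFamily (f ∘ ((↑) : s → I)) := h.comp (Subtype.strictMono_coe _)
  exact ⟨_, hs.isUniformSubset_range, mk_range_eq _ hs.injective⟩

theorem HasUniform.exists_family {P : Type u} [PartialOrder P] {c : Cardinal.{u}}
    (h : HasUniform P c) : ∃ f : c.ord.ToType → P, IsUniformFamily f := by
  obtain ⟨A, hA, rfl⟩ := h
  rcases hA with hA | hA | hA
  · obtain ⟨e⟩ : Nonempty ((#A).ord.ToType ≃ A) := Cardinal.eq.1 (mk_ord_toType _)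
    refine ⟨fun i => e i, Or.inr (Or.inr fun i j hij => ?_)⟩
    by_contra hne
    exact hA (e i).2 (e j).2 (fun h => hne (e.injective (Subtype.ext h))) hij
  · have := ord_le_type (fun a b : A => (a : P) < (b : P))
    rw [← Ordinal.type_toType (#A).ord, Ordinal.type_le_iff'] at this
    obtain ⟨e⟩ := this
    exact ⟨fun i => e i, Or.inl fun i j hij => e.map_rel_iff.2 hij⟩
  · have := ord_le_type (fun a b : A => (b : P) < (a : P))
    rw [← Ordinal.type_toType (#A).ord, Ordinal.type_le_iff'] at this
    obtain ⟨e⟩ := this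
    exact ⟨fun i => e i, Or.inr (Or.inl fun i j hij => e.map_rel_iff.2 hij)⟩

theorem HasUniform.mono {P : Type u} [PartialOrder P] {c d : Cardinal.{u}}
    (h : HasUniform P d) (hcd : c ≤ d) : HasUniform P c := by
  obtain ⟨f, hf⟩ := h.exists_family
  exact hf.hasUniform (by simpa using hcd)

theorem HasUniform.map {P Q : Type u} [PartialOrder P] [PartialOrder Q] {c : Cardinal.{u}}
    (h : HasUniform P c) (e : P ↪o Q) : HasUniform Q c := by
  obtain ⟨f, hf⟩ := h.exists_family
  have : IsUniformFamily (e ∘ f) := by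
    rcases hf with hf | hf | hf
    · exact Or.inl (e.strictMono.comp hf)
    · exact Or.inr (Or.inl (e.strictMono.comp_strictAnti hf))
    · exact Or.inr (Or.inr fun i j hij => hf _ _ (e.le_iff_le.1 hij))
  exact this.hasUniform (by simp)

theorem HasUniform.le_mk {P : Type u} [PartialOrder P] {c : Cardinal.{u}}
    (h : HasUniform P c) : c ≤ #P := by
  obtain ⟨A, -, rfl⟩ := h
  exact mk_set_le A

theorem lt_muCard_iff {P : Type u} [PartialOrder P] {c : Cardinal.{u}} :
    c < muCard P ↔ HasUniform P c := by
  have hne : {c : Cardinal.{u} | ¬ ∃ A : Set P, IsUniformSubset A ∧ #A = c}.Nonempty :=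
    ⟨Order.succ #P, fun h => (Order.lt_succ #P).not_ge (HasUniform.le_mk h)⟩
  constructor
  · intro h
    exact not_not.1 (notMem_of_lt_csInf' h)
  · intro h
    refine lt_of_not_ge fun hle => csInf_mem hne (h.mono hle)

theorem lt_muInfCard_iff {L : Type u} [PartialOrder L] {c : Cardinal.{u}} :
    c < muInfCard L ↔ ∃ n : ℕ, HasUniform (Fin (n + 1) → L) c := by
  simp only [← lt_muCard_iff]
  exact lt_ciSup_iff (bddAbove_of_small)

theorem HasAntichainFamily.lt_nuCard {P L I : Type u} [PartialOrder P] [PartialOrder L]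
    (h : HasAntichainFamily (P →o L) I) : #I < nuCard P L := by
  have hne : {c : Cardinal.{u} | ¬ ∃ F : Set (P →o L), IsAntichain (· ≤ ·) F ∧ #F = c}.Nonempty := by
    refine ⟨Order.succ #(P →o L), ?_⟩
    rintro ⟨F, -, hF⟩
    exact (Order.lt_succ #(P →o L)).not_ge (hF ▸ mk_set_le F)
  refine lt_of_not_ge fun hle => csInf_mem hne ?_
  obtain ⟨s, hs⟩ := le_mk_iff_exists_set.1 hle
  obtain ⟨F, hF, hc⟩ := (h.comap (Function.Embedding.subtype (· ∈ s))).exists_set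
  exact ⟨F, hF, hc.trans hs⟩

/-! ### Coding a family of monotone functions by one function. -/

section Selection

variable {ι P Q R : Type*} [PartialOrder P] [Preorder Q] [PartialOrder R] [BoundedOrder R]

open Classical in
/-- Given a family `φ` of monotone functions indexed by an antichain `b` in `P`, the function on
`P × Q` that behaves like `φ i` above `b i`. -/
noncomputable def selectAlong (b : ι → P) (φ : ι → (Q →o R)) (x : P × Q) : R :=
  if ∃ i j, i ≠ j ∧ b i ≤ x.1 ∧ b j ≤ x.1 then ⊤
  else if h : ∃ i, b i ≤ x.1 then φ h.choose x.2 else ⊥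

/-- Going up in `P`, a point passes from lying above no `b i`, to exactly one, to several. The
values `⊥`, `φ i`, `⊤` follow this order, and the index `i` cannot change within the middle stage.
-/
theorem selectAlong_monotone (b : ι → P) (φ : ι → (Q →o R)) : Monotone (selectAlong b φ) := by
  intro x y hxy
  unfold selectAlong
  by_cases h2 : ∃ i j, i ≠ j ∧ b i ≤ y.1 ∧ b j ≤ y.1
  · rw [if_pos h2]; exact le_top
  · have h2' : ¬ ∃ i j, i ≠ j ∧ b i ≤ x.1 ∧ b j ≤ x.1 := fun ⟨i, j, h, hi, hj⟩ =>
      h2 ⟨i, j, h, hi.trans hxy.1, hj.trans hxy.1⟩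
    rw [if_neg h2, if_neg h2']
    by_cases h1 : ∃ i, b i ≤ x.1
    · have h1' : ∃ i, b i ≤ y.1 := h1.imp fun i hi => hi.trans hxy.1
      rw [dif_pos h1, dif_pos h1']
      have : h1.choose = h1'.choose := by
        by_contra hne
        exact h2 ⟨_, _, hne, h1.choose_spec.trans hxy.1, h1'.choose_spec⟩
      rw [this]
      exact (φ _).monotone hxy.2
    · rw [dif_neg h1]; exact bot_le

theorem selectAlong_apply {b : ι → P} (hb : ∀ i j, b i ≤ b j → i = j) (φ : ι → (Q →o R))
    (i : ι) (q : Q) : selectAlong b φ (b i, q) = φ i q := by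
  have h1 : ∃ j, b j ≤ b i := ⟨i, le_rfl⟩
  unfold selectAlong
  rw [if_neg, dif_pos h1, hb _ _ h1.choose_spec]
  rintro ⟨j, k, hne, hj, hk⟩
  exact hne ((hb _ _ hj).trans (hb _ _ hk).symm)

theorem selectAlong_le_iff {b : ι → P} (hb : ∀ i j, b i ≤ b j → i = j) (φ ψ : ι → (Q →o R)) :
    selectAlong b φ ≤ selectAlong b ψ ↔ φ ≤ ψ := by
  constructor
  · intro h i q
    have := h (b i, q)
    rwa [selectAlong_apply hb, selectAlong_apply hb] at this
  · intro h x
    unfold selectAlong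
    split_ifs
    · exact le_rfl
    · exact h _ _
    · exact le_rfl

/-- Families of monotone functions indexed by an antichain are coded by single functions. -/
noncomputable def selectEmbedding {b : ι → P} (hb : ∀ i j, b i ≤ b j → i = j) :
    (ι → (Q →o R)) ↪o (P × Q →o R) :=
  OrderEmbedding.ofMapLEIff (fun φ => ⟨selectAlong b φ, selectAlong_monotone b φ⟩)
    (selectAlong_le_iff hb)

open Classical in
theorem exists_unit_antichain (ι R : Type*) [PartialOrder R] [BoundedOrder R] [Nontrivial R] :
    ∃ b : ι → (ι → R), ∀ i j, b i ≤ b j → i = j := by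
  refine ⟨fun i j => if i = j then ⊤ else ⊥, fun i j h => ?_⟩
  by_contra hne
  have := h i
  simp [Ne.symm hne] at this

/-- The unit vectors of `ι → R` serve as selectors, so `ι` many functions cost only `ι` extra
coordinates. -/
theorem HasAntichainFamily.select_unit {J : Type*} [Nontrivial R]
    (h : HasAntichainFamily (ι → (Q →o R)) J) :
    HasAntichainFamily ((ι → R) × Q →o R) J := by
  obtain ⟨b, hb⟩ := exists_unit_antichain ι R
  exact h.map (selectEmbedding hb)

theorem HasAntichainFamily.select_bool {J : Type*} [Nontrivial R]
    (h : HasAntichainFamily ((Q →o R) × (Q →o R)) J) :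
    HasAntichainFamily ((Bool → R) × Q →o R) J := by
  refine HasAntichainFamily.select_unit (h.map (OrderEmbedding.ofMapLEIff
    (fun F i => cond i F.1 F.2) fun F G => ⟨fun hle => ⟨hle true, hle false⟩, ?_⟩))
  rintro ⟨h1, h2⟩ (_ | _)
  exacts [h2, h1]

end Selection

/-! ### Power sets inside the monotone self-maps of an order. -/

section PowerSet

variable {I P : Type*} [LinearOrder I] [PartialOrder P]

open Classical in
/-- The map `i ↦ i + 1` on `S` and `i ↦ i` off `S`. -/
noncomputable def bumpOn [SuccOrder I] (S : Set I) (i : I) : I := if i ∈ S then Order.succ i else i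

theorem bumpOn_monotone [SuccOrder I] (S : Set I) : Monotone (bumpOn S) := by
  refine monotone_iff_forall_lt.2 fun i j hij => ?_
  have h1 : bumpOn S i ≤ Order.succ i := by
    unfold bumpOn; split_ifs; exacts [le_rfl, Order.le_succ i]
  have h2 : j ≤ bumpOn S j := by
    unfold bumpOn; split_ifs; exacts [Order.le_succ j, le_rfl]
  exact h1.trans ((Order.succ_le_of_lt hij).trans h2)

open Classical in
/-- The extension to `P` of a function on a well-ordered chain `a` in `P`. -/
noncomputable def extendChain [WellFoundedLT I] [OrderTop P] (a : I → P) (h : I → I) (x : P) : P :=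
  if hx : {i | ¬ a i < x}.Nonempty then a (h (wellFounded_lt.min _ hx)) else ⊤

/-- A larger `x` has fewer indices with `¬ a i < x`, so the least such index grows. -/
theorem extendChain_monotone [WellFoundedLT I] [OrderTop P] {a : I → P} (ha : Monotone a) {h : I → I}
    (hh : Monotone h) : Monotone (extendChain a h) := by
  intro x y hxy
  unfold extendChain
  by_cases hy : {i | ¬ a i < y}.Nonempty
  · have hsub : {i | ¬ a i < y} ⊆ {i | ¬ a i < x} := fun i hi hlt => hi (hlt.trans_le hxy)
    have hx := hy.mono hsub
    rw [dif_pos hx, dif_pos hy]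
    exact ha (hh (WellFounded.min_le _ (hsub (wellFounded_lt.min_mem _ hy))))
  · rw [dif_neg hy]; exact le_top

theorem extendChain_apply [WellFoundedLT I] [OrderTop P] {a : I → P} (ha : StrictMono a) (h : I → I) (i : I) :
    extendChain a h (a i) = a (h i) := by
  have hx : {j | ¬ a j < a i}.Nonempty := ⟨i, lt_irrefl _⟩
  unfold extendChain
  rw [dif_pos hx]
  congr 2
  refine le_antisymm (WellFounded.min_le _ (lt_irrefl _)) ?_
  have := wellFounded_lt.min_mem _ hx
  exact not_lt.1 fun hlt => this (ha hlt)

/-- The map coded by `S` moves `a i` to its successor in the chain exactly when `i ∈ S`, so `S` can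
be read off. -/
theorem exists_powerSet_embedding_of_strictMono [WellFoundedLT I] [OrderTop P] [SuccOrder I] [NoMaxOrder I]
    {a : I → P} (ha : StrictMono a) : Nonempty (Set I ↪o (P →o P)) := by
  refine ⟨OrderEmbedding.ofMapLEIff
    (fun S => ⟨extendChain a (bumpOn S), extendChain_monotone ha.monotone (bumpOn_monotone S)⟩)
    fun S T => ⟨fun h i hi => ?_, fun h x => ?_⟩⟩
  · have := h (a i)
    simp only [OrderHom.coe_mk, extendChain_apply ha, ha.le_iff_le] at this
    by_contra hT
    rw [bumpOn, bumpOn, if_pos hi, if_neg hT] at this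
    exact (Order.lt_succ i).not_ge this
  · simp only [OrderHom.coe_mk, extendChain]
    split_ifs
    · refine ha.monotone ?_
      unfold bumpOn
      split_ifs with h1 h2 h2
      · exact le_rfl
      · exact absurd (h h1) h2
      · exact Order.le_succ _
      · exact le_rfl
    · exact le_rfl

-- A subset `S` is coded by the indicator of the upper set generated by the `a i` with `i ∈ S`.
open Classical in
theorem exists_powerSet_embedding_of_antichain {I : Type*} [BoundedOrder P] [Nontrivial P]
    {a : I → P} (ha : ∀ i j, a i ≤ a j → i = j) : Nonempty (Set I ↪o (P →o P)) := by
  have hm : ∀ S : Set I, Monotone fun x : P => if ∃ i ∈ S, a i ≤ x then (⊤ : P) else ⊥ := by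
    intro S x y hxy
    dsimp only
    split_ifs with h1 h2
    · exact le_rfl
    · exact absurd (h1.imp fun i hi => ⟨hi.1, hi.2.trans hxy⟩) h2
    · exact bot_le
    · exact le_rfl
  refine ⟨OrderEmbedding.ofMapLEIff (fun S => ⟨_, hm S⟩) fun S T => ⟨fun h i hi => ?_, fun h x => ?_⟩⟩
  · have := h (a i)
    simp only [OrderHom.coe_mk] at this
    rw [if_pos ⟨i, hi, le_rfl⟩] at this
    split_ifs at this with h1
    · obtain ⟨j, hj, hji⟩ := h1
      exact ha _ _ hji ▸ hj
    · exact absurd this (by simp)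
  · simp only [OrderHom.coe_mk]
    split_ifs with h1 h2
    · exact le_rfl
    · exact absurd (h1.imp fun i hi => ⟨h hi.1, hi.2⟩) h2
    · exact bot_le
    · exact le_rfl

theorem IsUniformFamily.exists_powerSet_embedding [WellFoundedLT I] [BoundedOrder P] [Nontrivial P] [SuccOrder I]
    [NoMaxOrder I] {a : I → P} (ha : IsUniformFamily a) : Nonempty (Set I ↪o (P →o P)) := by
  rcases ha with ha | ha | ha
  · exact exists_powerSet_embedding_of_strictMono ha
  · obtain ⟨e⟩ := exists_powerSet_embedding_of_strictMono (P := Pᵒᵈ) (a := OrderDual.toDual ∘ a)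
      ha.dual_right
    -- Dualizing reverses the order of functions; the complement reverses it back.
    refine ⟨OrderEmbedding.ofMapLEIff (fun S => OrderHom.dual.symm (e Sᶜ)) fun S T => ?_⟩
    rw [← Set.compl_subset_compl, ← e.le_iff_le]
    exact Iff.rfl
  · exact exists_powerSet_embedding_of_antichain ha

end PowerSet

/-! ### Transfer to functions on finite powers of `L`. -/

section Power

variable {L : Type*} [PartialOrder L]

/-- `P` is a monotone image of a positive finite power of `L`. -/
def IsPowerImage (L P : Type*) [Preorder L] [Preorder P] : Prop :=
  ∃ (n : ℕ) (g : (Fin (n + 1) → L) → P), Monotone g ∧ Function.Surjective g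

theorem IsPowerImage.pi {ι : Type*} [Finite ι] [Nonempty ι] : IsPowerImage L (ι → L) := by
  obtain ⟨n, ⟨e⟩⟩ := Finite.exists_equiv_fin ι
  cases n with
  | zero => exact (e (Classical.arbitrary ι)).elim0
  | succ n => exact ⟨n, fun x i => x (e i), fun x y h i => h (e i), fun y =>
      ⟨fun j => y (e.symm j), by simp⟩⟩

theorem IsPowerImage.self : IsPowerImage L L :=
  ⟨0, fun x => x 0, fun _ _ h => h 0, fun y => ⟨fun _ => y, rfl⟩⟩

theorem IsPowerImage.prod {P Q : Type*} [Preorder P] [Preorder Q] (hP : IsPowerImage L P)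
    (hQ : IsPowerImage L Q) : IsPowerImage L (P × Q) := by
  obtain ⟨m, g, hg, hgs⟩ := hP
  obtain ⟨n, h, hh, hhs⟩ := hQ
  obtain ⟨k, f, hf, hfs⟩ := IsPowerImage.pi (L := L) (ι := Fin (m + 1) ⊕ Fin (n + 1))
  refine ⟨k, fun x => (g fun i => f x (Sum.inl i), h fun i => f x (Sum.inr i)),
    fun x y hxy => ⟨hg fun i => hf hxy _, hh fun i => hf hxy _⟩, fun ⟨p, q⟩ => ?_⟩
  obtain ⟨a, rfl⟩ := hgs p
  obtain ⟨b, rfl⟩ := hhs q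
  obtain ⟨x, hx⟩ := hfs (Sum.elim a b)
  exact ⟨x, by simp [hx]⟩

/-- Precomposition with a monotone surjection is an order embedding of function spaces. -/
theorem IsPowerImage.hasAntichainFamily {P J : Type*} [Preorder P] (hP : IsPowerImage L P)
    (h : HasAntichainFamily (P →o L) J) :
    ∃ n : ℕ, HasAntichainFamily ((Fin (n + 1) → L) →o L) J := by
  obtain ⟨n, g, hg, hgs⟩ := hP
  exact ⟨n, h.map (OrderEmbedding.ofMapLEIff (fun φ => φ.comp ⟨g, hg⟩)
    fun φ ψ => (hgs.forall (p := fun y => φ y ≤ ψ y)).symm)⟩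

/-- The pair of self-maps coding `S` and its complement has `2(n + 1)` components with values in
`L`; these are packed into one function. -/
theorem IsUniformFamily.hasAntichainFamily {I : Type*} [LinearOrder I] [WellFoundedLT I]
    [SuccOrder I] [NoMaxOrder I] [BoundedOrder L] [Nontrivial L] {n : ℕ}
    {a : I → Fin (n + 1) → L} (ha : IsUniformFamily a) :
    HasAntichainFamily ((Fin (n + 1) ⊕ Fin (n + 1) → L) × (Fin (n + 1) → L) →o L) (Set I) := by
  obtain ⟨e⟩ := ha.exists_powerSet_embedding
  refine HasAntichainFamily.select_unit ((hasAntichainFamily_prod_of_embedding e).map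
    (OrderEmbedding.ofMapLEIff (fun F => Sum.elim
      (fun i => (⟨fun x => F.1 x i, fun x y h => F.1.monotone h i⟩ : (Fin (n + 1) → L) →o L))
      (fun i => ⟨fun x => F.2 x i, fun x y h => F.2.monotone h i⟩))
    fun F G => ⟨fun h => ⟨fun x i => h (Sum.inl i) x, fun x i => h (Sum.inr i) x⟩, ?_⟩))
  rintro ⟨h1, h2⟩ (i | i) x
  exacts [h1 x i, h2 x i]

end Power

/-! ### The Erdős–Rado tree argument. -/

section EndHomogeneous

variable {I P K : Type*} [LinearOrder I] [WellFoundedLT I] [Nonempty P]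

/-- The sequence in `P` following the prescribed colours `s`. -/
noncomputable def colourNode (col : P → P → K) (s : I → K) : I → P :=
  wellFounded_lt.fix fun i b => Classical.epsilon fun y =>
    ∀ j (hj : j < i), y ≠ b j hj ∧ col (b j hj) y = s j

theorem colourNode_eq (col : P → P → K) (s : I → K) (i : I) :
    colourNode col s i = Classical.epsilon fun y =>
      ∀ j, j < i → y ≠ colourNode col s j ∧ col (colourNode col s j) y = s j :=
  wellFounded_lt.fix_eq _ i

/-- A node depends only on the colours strictly below its level, which bounds the number of nodes.
-/
theorem colourNode_congr (col : P → P → K) {s t : I → K} (i : I) (h : ∀ j < i, s j = t j) :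
    colourNode col s i = colourNode col t i := by
  induction i using WellFoundedLT.induction with
  | ind i ih =>
    rw [colourNode_eq, colourNode_eq]
    congr 1
    ext y
    refine forall₂_congr fun j hj => ?_
    rw [ih j hj fun k hk => h k (hk.trans hj), h j hj]

/-- The sequence in `P` following the colours with respect to `x`. -/
noncomputable def colourBranch (I : Type*) [LinearOrder I] [WellFoundedLT I] (col : P → P → K)
    (x : P) : I → P :=
  wellFounded_lt.fix fun i b => Classical.epsilon fun y =>
    ∀ j (hj : j < i), y ≠ b j hj ∧ col (b j hj) y = col (b j hj) x

theorem colourBranch_eq (col : P → P → K) (x : P) (i : I) :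
    colourBranch I col x i = Classical.epsilon fun y =>
      ∀ j, j < i → y ≠ colourBranch I col x j ∧
        col (colourBranch I col x j) y = col (colourBranch I col x j) x :=
  wellFounded_lt.fix_eq _ i

/-- Each branch runs through the tree of nodes, so an `x` that is not a node differs from every
entry of its own branch and witnesses each choice. -/
theorem colourBranch_eq_colourNode (col : P → P → K) (x : P) (i : I) :
    colourBranch I col x i = colourNode col (fun j => col (colourBranch I col x j) x) i := by
  induction i using WellFoundedLT.induction with
  | ind i ih =>
    rw [colourNode_eq, colourBranch_eq]
    congr 1
    ext y
    refine forall₂_congr fun j hj => ?_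
    rw [← ih j hj]

/-- An element outside the tree of nodes yields an end-homogeneous sequence. -/
theorem colourBranch_spec (col : P → P → K) {x : P}
    (hx : ∀ (s : I → K) (i : I), colourNode col s i ≠ x) (i j : I) (hj : j < i) :
    colourBranch I col x i ≠ colourBranch I col x j ∧
      col (colourBranch I col x j) (colourBranch I col x i) = col (colourBranch I col x j) x := by
  have hex : ∃ y, ∀ j, j < i → y ≠ colourBranch I col x j ∧
      col (colourBranch I col x j) y = col (colourBranch I col x j) x := by
    refine ⟨x, fun j _ => ⟨?_, rfl⟩⟩
    rw [colourBranch_eq_colourNode]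
    exact (hx _ _).symm
  have := Classical.epsilon_spec hex
  rw [← colourBranch_eq] at this
  exact this j hj

end EndHomogeneous

theorem le_two_powerlt (c : Cardinal.{u}) : c ≤ 2 ^< c := by
  refine le_of_not_gt fun h => ?_
  exact (cantor _).not_ge (le_powerlt 2 h)

/-- A tree of height `c` whose levels are indexed by pairs of subsets has at most `2 ^< c` nodes. -/
theorem mk_sigma_set_Iio_le {c : Cardinal.{u}} (hc : ℵ₀ ≤ c) :
    #(Σ i : c.ord.ToType, Set (Set.Iio i) × Set (Set.Iio i)) ≤ 2 ^< c := by
  have h0 : ℵ₀ ≤ 2 ^< c := hc.trans (le_two_powerlt c)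
  have h1 : ∀ i : c.ord.ToType, #(Set (Set.Iio i) × Set (Set.Iio i)) ≤ 2 ^< c := by
    intro i
    have hi : #(Set.Iio i) < c := by simpa using mk_Iio_lt i (by simp)
    rw [mk_prod, lift_id, mk_set]
    exact (mul_le_mul' (le_powerlt 2 hi) (le_powerlt 2 hi)).trans (mul_eq_self h0).le
  rw [mk_sigma]
  refine (Cardinal.sum_le_sum _ (fun _ => 2 ^< c) h1).trans ?_
  rw [sum_const, lift_id, lift_id, mk_ord_toType]
  exact (mul_le_mul' (le_two_powerlt c) le_rfl).trans (mul_eq_self h0).le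

/-- A form of the Erdős–Rado theorem for comparability in partial orders. -/
theorem hasUniform_of_powerlt_lt {P : Type u} [PartialOrder P] {c : Cardinal.{u}} (hc : ℵ₀ ≤ c)
    (h : 2 ^< c < #P) : HasUniform P c := by
  have : Nonempty P := mk_ne_zero_iff.1 (h.bot_lt.ne')
  let I := c.ord.ToType
  let col : P → P → Prop × Prop := fun x y => (x ≤ y, y ≤ x)
  -- The tree has at most `2 ^< c` nodes, too few to exhaust `P`.
  obtain ⟨x, hx⟩ : ∃ x, ∀ (s : I → Prop × Prop) (i : I), colourNode col s i ≠ x := by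
    by_contra! hcon
    let F : (Σ i : I, Set (Set.Iio i) × Set (Set.Iio i)) → P := fun p =>
      colourNode col (fun j => (∃ hj : j < p.1, ⟨j, hj⟩ ∈ p.2.1, ∃ hj : j < p.1, ⟨j, hj⟩ ∈ p.2.2)) p.1
    have hF : Function.Surjective F := by
      intro x
      obtain ⟨s, i, rfl⟩ := hcon x
      refine ⟨⟨i, {j | (s j).1}, {j | (s j).2}⟩, colourNode_congr col i fun j hj => ?_⟩
      simp [hj]
    exact h.not_ge ((mk_le_of_surjective hF).trans (mk_sigma_set_Iio_le hc))
  have hspec := colourBranch_spec col hx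
  set b := colourBranch I col x with hb
  have hI : #I = c := mk_ord_toType c
  -- There are only four colours and `c` has infinite cofinality, so `c` many entries have the same
  -- colour towards `x`, even for singular `c`. By end-homogeneity they have it towards all later
  -- entries.
  obtain ⟨⟨⟨p⟩, ⟨q⟩⟩, hk⟩ := infinite_pigeonhole
    (fun i : I => ((⟨b i ≤ x⟩, ⟨x ≤ b i⟩) : ULift.{u} Prop × ULift.{u} Prop)) (hI ▸ hc) (by
      refine (lt_aleph0_of_finite _).trans_le ?_
      rw [hI, Ordinal.aleph0_le_cof_iff, Ordinal.one_lt_cof_iff]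
      exact isSuccLimit_ord hc)
  set J := (fun i : I => ((⟨b i ≤ x⟩, ⟨x ≤ b i⟩) : ULift.{u} Prop × ULift.{u} Prop)) ⁻¹'
    {(⟨p⟩, ⟨q⟩)} with hJ
  have hp : ∀ i : J, (b i ≤ x) = p := fun i => congrArg (fun z => z.1.down) i.2
  have hq : ∀ i : J, (x ≤ b i) = q := fun i => congrArg (fun z => z.2.down) i.2
  have hlt : ∀ i j : J, j < i → b i ≠ b j ∧ (b j ≤ b i) = p ∧ (b i ≤ b j) = q := by
    intro i j hij
    obtain ⟨h1, h2⟩ := hspec i j hij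
    exact ⟨h1, (congrArg Prod.fst h2).trans (hp j), (congrArg Prod.snd h2).trans (hq j)⟩
  have huni : IsUniformFamily fun i : J => b i := by
    by_cases hp' : p
    · exact Or.inl fun j i hij => lt_of_le_of_ne ((hlt i j hij).2.1 ▸ hp') (hlt i j hij).1.symm
    by_cases hq' : q
    · exact Or.inr (Or.inl fun j i hij => lt_of_le_of_ne ((hlt i j hij).2.2 ▸ hq') (hlt i j hij).1)
    · refine Or.inr (Or.inr fun i j hij => ?_)
      rcases lt_trichotomy i j with h | h | h
      · exact absurd ((hlt j i h).2.1 ▸ hij) hp'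
      · exact h
      · exact absurd ((hlt i j h).2.2 ▸ hij) hq'
  exact huni.hasUniform (by rw [hJ, hk, hI])

/-! ### Stacking chains in well-quasi-orders. -/

theorem Cardinal.IsRegular.exists_forall_lt {c : Cardinal.{u}} (hc : c.IsRegular)
    {s : Set c.ord.ToType} (hs : #s < c) : ∃ j, ∀ i ∈ s, i < j := by
  have : ¬ IsCofinal s := fun h => (Order.cof_le h).not_gt (by
    rwa [Ordinal.cof_toType, hc.cof_ord])
  simpa [IsCofinal] using this

theorem mk_Ioi_ord_toType {c : Cardinal.{u}} (hc : ℵ₀ ≤ c) (i : c.ord.ToType) :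
    #(Set.Ioi i) = c := by
  have := Cardinal.noMaxOrder hc
  have hI : Infinite c.ord.ToType := infinite_iff.2 (by simpa using hc)
  have h : #(Set.Iic i) < #c.ord.ToType := by
    rw [← Order.Iio_succ]
    exact mk_Iio_lt _ (by simp)
  have := mk_compl_of_infinite _ h
  rwa [Set.compl_Iic, mk_ord_toType] at this

/-- Ramsey's theorem applies to the transitive relation "one element of `A n` bounds all of `A m`".
If it fails along a whole subsequence, then for `k < l` some entry of the `k`-th chain is below
nothing in the `l`-th, by regularity of the longer length. As the lengths have uncountable
cofinality, one entry of each chain lies beyond all these witnesses, and these entries form a bad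
sequence. -/
theorem exists_increasing_of_wellQuasiOrdered {L : Type u} [PartialOrder L] [WellQuasiOrderedLE L]
    {κ : ℕ → Cardinal.{u}} (hreg : ∀ n, (κ n).IsRegular) (hunc : ∀ n, ℵ₀ < κ n)
    (hκ : StrictMono κ) (A : ∀ n, (κ n).ord.ToType → L) (hA : ∀ n, StrictMono (A n)) :
    ∃ g : ℕ ↪o ℕ, ∀ k l, k < l → ∃ j, ∀ i, A (g k) i ≤ A (g l) j := by
  let r : ℕ → ℕ → Prop := fun m n => ∃ j, ∀ i, A m i ≤ A n j
  have : IsTrans ℕ r := ⟨fun a b c ⟨j, hj⟩ ⟨k, hk⟩ => ⟨k, fun i => (hj i).trans (hk j)⟩⟩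
  obtain ⟨g, hg | hg⟩ := exists_increasing_or_nonincreasing_subseq r id
  · exact ⟨g, hg⟩
  exfalso
  have h1 : ∀ k l, k < l → ∃ i, ∀ j, ¬ A (g k) i ≤ A (g l) j := by
    intro k l hkl
    by_contra! hcon
    choose f hf using hcon
    have hcard : #(Set.range f) < κ (g l) := by
      refine mk_range_le.trans_lt ?_
      rw [mk_ord_toType]
      exact hκ (g.strictMono hkl)
    obtain ⟨j, hj⟩ := (hreg (g l)).exists_forall_lt hcard
    exact hg k l hkl ⟨j, fun i => (hf i).trans ((hA _).monotone (hj _ ⟨i, rfl⟩).le)⟩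
  choose f hf using h1
  have h2 : ∀ k, ∃ i, ∀ l (hkl : k < l), f k l hkl < i := by
    intro k
    let s := Set.range fun l : {l // k < l} => f k l l.2
    have hs : #s < κ (g k) := (le_aleph0_iff_set_countable.2 (Set.countable_range _)).trans_lt
      (hunc _)
    obtain ⟨i, hi⟩ := (hreg (g k)).exists_forall_lt hs
    exact ⟨i, fun l hkl => hi _ ⟨⟨l, hkl⟩, rfl⟩⟩
  choose i hi using h2
  obtain ⟨k, l, hkl, hle⟩ := wellQuasiOrdered_le fun k => A (g k) (i k)
  exact hf k l hkl (i l) (((hA _) (hi k l hkl)).le.trans hle)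

theorem exists_isChain_of_wellQuasiOrdered {L : Type u} [PartialOrder L] [WellQuasiOrderedLE L]
    {κ : ℕ → Cardinal.{u}} (hreg : ∀ n, (κ n).IsRegular) (hunc : ∀ n, ℵ₀ < κ n)
    (hκ : StrictMono κ) (A : ∀ n, (κ n).ord.ToType → L) (hA : ∀ n, StrictMono (A n)) :
    ∃ U : Set L, (∀ n, κ n ≤ #U) ∧ IsChain (· ≤ ·) U := by
  obtain ⟨g, hg⟩ := exists_increasing_of_wellQuasiOrdered hreg hunc hκ A hA
  -- `T k` is the part of the `k`-th chain above all earlier chains. It contains a tail, hence has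
  -- full size, and members of different `T k` are comparable.
  let T : ℕ → Set L := fun k => {x | x ∈ Set.range (A (g k)) ∧ ∀ m < k, ∀ i, A (g m) i ≤ x}
  have hT : ∀ k, κ (g k) ≤ #(T k) := by
    intro k
    choose f hf using fun m : Set.Iio k => hg m k m.2
    obtain ⟨j, hj⟩ := (hreg (g k)).exists_forall_lt (s := Set.range f)
      ((le_aleph0_iff_set_countable.2 (Set.countable_range _)).trans_lt (hunc _))
    rw [← mk_Ioi_ord_toType (hunc (g k)).le j]
    refine mk_le_of_injective (f := fun i => (⟨A (g k) i, ⟨i, rfl⟩, fun m hm i' => ?_⟩ : T k)) ?_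
    · exact (hf ⟨m, hm⟩ i').trans ((hA _).monotone ((hj _ ⟨_, rfl⟩).trans i.2).le)
    · intro i i' h
      exact Subtype.ext ((hA _).injective (congrArg Subtype.val h))
  refine ⟨⋃ k, T k, fun n => ?_, ?_⟩
  · exact (hκ.monotone (g.strictMono.le_apply)).trans
      ((hT n).trans (mk_le_mk_of_subset (Set.subset_iUnion T n)))
  · rintro x hx y hy -
    obtain ⟨k, ⟨i, rfl⟩, hxk⟩ := Set.mem_iUnion.1 hx
    obtain ⟨l, ⟨j, rfl⟩, hyl⟩ := Set.mem_iUnion.1 hy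
    rcases lt_trichotomy k l with h | rfl | h
    · exact Or.inl (hyl k h i)
    · exact (le_total i j).imp (fun h => (hA _).monotone h) (fun h => (hA _).monotone h)
    · exact Or.inr (hxk l h j)

/-- A chain in a well-founded partial order is uniform. -/
theorem IsChain.isUniformSubset {L : Type u} [PartialOrder L] [WellFoundedLT L] {U : Set L}
    (hU : IsChain (· ≤ ·) U) : IsUniformSubset U := by
  refine Or.inr (Or.inl ?_)
  have h1 : IsWellFounded U (fun a b => (a : L) < b) := ⟨InvImage.wf _ wellFounded_lt⟩
  have h2 : Std.Trichotomous (fun a b : U => (a : L) < b) := ⟨fun a b h h' => by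
    by_contra hne
    have hne' : (a : L) ≠ b := fun h => hne (Subtype.ext h)
    rcases hU a.2 b.2 hne' with hle | hle
    · exact h (lt_of_le_of_ne hle hne')
    · exact h' (lt_of_le_of_ne hle hne'.symm)⟩
  exact ⟨⟩

theorem IsUniformSubset.ofDual {L : Type u} [PartialOrder L] {A : Set Lᵒᵈ}
    (hA : IsUniformSubset A) : IsUniformSubset (L := L) (OrderDual.toDual ⁻¹' A) := by
  rcases hA with hA | hA | hA
  · exact Or.inl fun x hx y hy hne hle => hA hy hx hne.symm hle
  · exact Or.inr (Or.inr hA)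
  · exact Or.inr (Or.inl hA)

theorem HasUniform.ofDual {L : Type u} [PartialOrder L] {c : Cardinal.{u}}
    (h : HasUniform Lᵒᵈ c) : HasUniform L c := by
  obtain ⟨A, hA, rfl⟩ := h
  exact ⟨_, hA.ofDual, rfl⟩

/-- In a well-quasi-order, infinite uniform families indexed by well-orders are increasing. -/
theorem IsUniformFamily.strictMono {I L : Type*} [LinearOrder I] [Infinite I] [WellFoundedLT I]
    [PartialOrder L] [WellQuasiOrderedLE L] {f : I → L} (hf : IsUniformFamily f) :
    StrictMono f := by
  rcases hf with hf | hf | hf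
  · exact hf
  · obtain ⟨g, hg | hg⟩ := Infinite.exists_strictMono_or_strictAnti I
    · have h := hf.comp_strictMono hg
      obtain ⟨m, n, hmn, hle⟩ := wellQuasiOrdered_le (f ∘ g)
      exact absurd (h hmn) hle.not_gt
    · exact absurd wellFounded_lt (RelEmbedding.not_wellFounded
        (r := ((· < ·) : I → I → Prop)) (RelEmbedding.ofMonotone g fun _ _ h => hg h))
  · obtain ⟨m, n, hmn, hle⟩ := wellQuasiOrdered_le fun n => f (Infinite.natEmbedding I n)
    exact absurd ((Infinite.natEmbedding I).injective (hf _ _ hle)) hmn.ne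

theorem HasUniform.of_wellQuasiOrdered {L : Type u} [PartialOrder L] [WellQuasiOrderedLE L]
    {κ : ℕ → Cardinal.{u}} (hreg : ∀ n, (κ n).IsRegular) (hunc : ∀ n, ℵ₀ < κ n)
    (hκ : StrictMono κ) (hL : ∀ n, HasUniform L (κ n)) {c : Cardinal.{u}}
    (hc : ∀ d, (∀ n, κ n ≤ d) → c ≤ d) : HasUniform L c := by
  choose A hA using fun n => (hL n).exists_family
  have hmono : ∀ n, StrictMono (A n) := fun n => by
    have : Infinite (κ n).ord.ToType := infinite_iff.2 (by simpa using (hunc n).le)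
    exact (hA n).strictMono
  obtain ⟨U, hU, hchain⟩ := exists_isChain_of_wellQuasiOrdered hreg hunc hκ A hmono
  exact HasUniform.mono ⟨U, hchain.isUniformSubset, rfl⟩ (hc _ hU)

/-- Either `L` or its square has an infinite antichain, or `L` or its dual is a well-quasi-order. -/
theorem infinite_antichain_or_wellQuasiOrdered (L : Type*) [PartialOrder L] :
    HasAntichainFamily L ℕ ∨ HasAntichainFamily (L × L) ℕ ∨ WellQuasiOrderedLE L ∨
      WellQuasiOrderedLE Lᵒᵈ := by
  by_cases h1 : HasAntichainFamily L ℕ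
  · exact Or.inl h1
  have hfin : ∀ s : Set L, IsAntichain (· ≤ ·) s → s.Finite := by
    intro s hs
    by_contra hinf
    have : Infinite s := Set.infinite_coe_iff.2 hinf
    let e := Infinite.natEmbedding s
    refine h1 ⟨fun n => e n, fun i j hij => e.injective ?_⟩
    by_contra hne
    exact hs (e i).2 (e j).2 (fun h => hne (Subtype.ext h)) hij
  by_cases h2 : WellFoundedLT L
  · exact Or.inr (Or.inr (Or.inl (wellQuasiOrderedLE_iff.2 ⟨h2, hfin⟩)))
  by_cases h3 : WellFoundedLT Lᵒᵈ
  · exact Or.inr (Or.inr (Or.inr (wellQuasiOrderedLE_iff.2 ⟨h3, fun s hs => hfin s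
      fun x hx y hy hne hle => hs hy hx hne.symm hle⟩)))
  refine Or.inr (Or.inl ?_)
  have key : ∀ (M : Type _) [PartialOrder M], ¬ WellFoundedLT M → ∃ f : ℕ → M, StrictAnti f := by
    intro M _ hM
    have : ¬ WellFounded ((· < ·) : M → M → Prop) := fun h => hM ⟨h⟩
    rw [RelEmbedding.wellFounded_iff_isEmpty, not_isEmpty_iff] at this
    obtain ⟨f⟩ := this
    exact ⟨f, fun m n h => f.map_rel_iff.2 h⟩
  obtain ⟨f, hf⟩ := key L h2
  obtain ⟨g, hg⟩ := key Lᵒᵈ h3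
  -- A decreasing sequence paired with an increasing one is an antichain in the square.
  refine ⟨fun n => (f n, OrderDual.ofDual (g n)), fun i j hij => ?_⟩
  exact le_antisymm (hg.le_iff_ge.1 hij.2) (hf.le_iff_ge.1 hij.1)

/-- Ramsey's theorem is used for `<` and then for `>`; if both fail, an antichain is left. -/
theorem hasUniform_aleph0 (L : Type u) [PartialOrder L] [Infinite L] : HasUniform L ℵ₀ := by
  suffices h : ∃ f : ℕ → L, IsUniformFamily f by
    obtain ⟨f, hf⟩ := h
    have hu : StrictMono (ULift.down : ULift.{u} ℕ → ℕ) := fun _ _ h => h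
    have : WellFoundedLT (ULift.{u} ℕ) := ⟨InvImage.wf ULift.down wellFounded_lt⟩
    exact (hf.comp hu).hasUniform (by simp)
  let f := Infinite.natEmbedding L
  obtain ⟨g, hg | hg⟩ := exists_increasing_or_nonincreasing_subseq (· < ·) f
  · exact ⟨f ∘ g, Or.inl fun m n h => hg m n h⟩
  obtain ⟨k, hk | hk⟩ := exists_increasing_or_nonincreasing_subseq (· > ·) (f ∘ g)
  · exact ⟨f ∘ g ∘ k, Or.inr (Or.inl fun m n h => hk m n h)⟩
  refine ⟨f ∘ g ∘ k, Or.inr (Or.inr fun i j hij => ?_)⟩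
  have hinj : ∀ i j, i ≠ j → f (g (k i)) ≠ f (g (k j)) := fun i j hne h =>
    hne (k.injective (g.injective (f.injective h)))
  rcases lt_trichotomy i j with h | h | h
  · exact absurd (lt_of_le_of_ne hij (hinj _ _ h.ne)) (hg _ _ (k.strictMono h))
  · exact h
  · exact absurd (lt_of_le_of_ne hij (hinj _ _ h.ne')) (hk _ _ h)

theorem HasUniform.lt_muInfCard {L : Type u} [PartialOrder L] {c : Cardinal.{u}}
    (h : HasUniform L c) : c < muInfCard L :=
  lt_muInfCard_iff.2 ⟨0, h.map (OrderEmbedding.ofMapLEIff (fun x _ => x)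
    fun _ _ => ⟨fun h => h 0, fun h _ => h⟩)⟩

/-- `c` is the supremum of `c.ord.cof` many smaller cardinals. -/
theorem exists_cofinal_cardinals {c : Cardinal.{u}} (hc : Order.IsSuccLimit c) :
    ∃ (ι : Type u) (κ : ι → Cardinal.{u}), #ι = c.ord.cof ∧ (∀ i, κ i < c) ∧
      ∀ d, (∀ i, κ i ≤ d) → c ≤ d := by
  obtain ⟨s, hs, hcard⟩ := Order.exists_cof_eq c.ord.ToType
  -- The successor makes the bound strict: any `d < c` satisfies `d ≤ card i` for some `i` in the
  -- cofinal set.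
  refine ⟨s, fun i => Order.succ (i.1.toOrd.1).card, by rw [hcard, Ordinal.cof_toType],
    fun i => hc.succ_lt (lt_ord.1 i.1.toOrd.2), fun d hd => ?_⟩
  by_contra! hlt
  obtain ⟨i, hi, hle⟩ := hs (Ordinal.ToType.mk ⟨d.ord, ord_lt_ord.2 hlt⟩)
  have h1 : d.ord ≤ i.toOrd.1 := by
    have := Ordinal.ToType.mk.symm.monotone hle
    rwa [OrderIso.symm_apply_apply] at this
  exact (Order.lt_succ _).not_ge ((hd ⟨i, hi⟩).trans (ord_le.1 h1))

/-! ### Inaccessibility of `|L|` from the hypothesis on `ν`. -/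

section Main

variable {L : Type u} [PartialOrder L]

theorem NuBoundedByMu.lt_muInfCard (hν : NuBoundedByMu L) {P J : Type u} [PartialOrder P]
    (hP : IsPowerImage L P) (h : HasAntichainFamily (P →o L) J) {c : Cardinal.{u}}
    (hc : ℵ₀ < c.ord.cof) (hcJ : c ≤ #J) : c < muInfCard L := by
  obtain ⟨n, hn⟩ := hP.hasAntichainFamily h
  exact hν n c hc (hcJ.trans_lt hn.lt_nuCard)

theorem HasUniform.hasAntichainFamily [BoundedOrder L] [Nontrivial L] {n : ℕ} {c : Cardinal.{u}}
    (hc : ℵ₀ ≤ c) (h : HasUniform (Fin (n + 1) → L) c) :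
    HasAntichainFamily ((Fin (n + 1) ⊕ Fin (n + 1) → L) × (Fin (n + 1) → L) →o L)
      (Set c.ord.ToType) := by
  obtain ⟨f, hf⟩ := h.exists_family
  have := Cardinal.noMaxOrder hc
  exact hf.hasAntichainFamily

variable [Infinite L]

theorem aleph0_lt_muInfCard : ℵ₀ < muInfCard L := (hasUniform_aleph0 L).lt_muInfCard

variable [BoundedOrder L]

/-- For infinite `c` the cofinality of `2 ^ c` exceeds `c`, so the hypothesis applies to the
antichain of `2 ^ c` functions. -/
theorem NuBoundedByMu.isStrongLimit (hν : NuBoundedByMu L) : IsStrongLimit (muInfCard L) := by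
  refine ⟨(bot_lt_of_lt aleph0_lt_muInfCard).ne', fun c hc => ?_⟩
  rcases lt_or_ge c ℵ₀ with h | h
  · exact (power_lt_aleph0 (natCast_lt_aleph0 (n := 2)) h).trans aleph0_lt_muInfCard
  obtain ⟨n, hn⟩ := lt_muInfCard_iff.1 hc
  refine hν.lt_muInfCard (IsPowerImage.pi.prod IsPowerImage.pi) (hn.hasAntichainFamily h)
    (h.trans_lt (lt_cof_ord_power h (by simp))) ?_
  rw [mk_set, mk_ord_toType]

/-- If `μ_∞ > |L|`, some finite power of `L` would contain `2 ^ |L|` elements. If `μ_∞ < |L|`, then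
`2 ^< μ_∞ ≤ μ_∞ < |L|` and Erdős–Rado produces a uniform set of size `μ_∞`. -/
theorem NuBoundedByMu.muInfCard_eq (hν : NuBoundedByMu L) : muInfCard L = #L := by
  refine le_antisymm (le_of_not_gt fun h => ?_) (le_of_not_gt fun h => ?_)
  · obtain ⟨n, hn⟩ := lt_muInfCard_iff.1 (hν.isStrongLimit.isStrongPrelimit h)
    have h1 := hn.le_mk
    rw [mk_pi, prod_const, mk_fin, lift_natCast, lift_uzero, power_natCast] at h1
    exact (cantor _).not_ge (h1.trans (power_nat_le (aleph0_le_mk L)))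
  · refine (hasUniform_of_powerlt_lt aleph0_lt_muInfCard.le (lt_of_le_of_lt ?_ h)).lt_muInfCard.false
    exact powerlt_le.2 fun x hx => (hν.isStrongLimit.isStrongPrelimit hx).le

theorem NuBoundedByMu.isStrongLimit_mk (hν : NuBoundedByMu L) : IsStrongLimit #L :=
  hν.muInfCard_eq ▸ hν.isStrongLimit

theorem NuBoundedByMu.hasUniform (hν : NuBoundedByMu L) {c : Cardinal.{u}} (hc : c < #L) :
    HasUniform L c := by
  refine HasUniform.mono (d := max c ℵ₀) ?_ (le_max_left _ _)
  have hlt : max c ℵ₀ < #L := max_lt hc (hν.muInfCard_eq ▸ aleph0_lt_muInfCard)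
  refine hasUniform_of_powerlt_lt (le_max_right _ _) (lt_of_le_of_lt ?_
    (hν.isStrongLimit_mk.isStrongPrelimit hlt))
  exact powerlt_le.2 fun x hx => power_le_power_left two_ne_zero hx.le

theorem NuBoundedByMu.not_hasUniform (hν : NuBoundedByMu L) : ¬ HasUniform L #L := fun h =>
  (hν.muInfCard_eq ▸ h.lt_muInfCard).false

theorem NuBoundedByMu.muCard_eq (hν : NuBoundedByMu L) : muCard L = #L := by
  refine le_antisymm (le_of_not_gt fun h => ?_) (le_of_forall_lt fun c hc => ?_)
  · exact hν.not_hasUniform (lt_muCard_iff.1 h)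
  · exact lt_muCard_iff.2 (hν.hasUniform hc)

/-- Each `c < #L` gives antichains of size `2 ^ c` among the monotone functions on one fixed
finite power of `L`. -/
theorem NuBoundedByMu.hasAntichainFamily (hν : NuBoundedByMu L) {c : Cardinal.{u}} (hc : c < #L) :
    HasAntichainFamily ((Fin 1 ⊕ Fin 1 → L) × (Fin 1 → L) →o L) (Set c.ord.ToType) := by
  have hlt : max c ℵ₀ < #L := max_lt hc (hν.muInfCard_eq ▸ aleph0_lt_muInfCard)
  have h := ((hν.hasUniform hlt).map (Q := Fin 1 → L) (OrderEmbedding.ofMapLEIff (fun x _ => x)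
    fun _ _ => ⟨fun h => h 0, fun h _ => h⟩)).hasAntichainFamily (n := 0) (le_max_right _ _)
  have hle : #(Set c.ord.ToType) ≤ #(Set (max c ℵ₀).ord.ToType) := by
    rw [mk_set, mk_set, mk_ord_toType, mk_ord_toType]
    exact power_le_power_left two_ne_zero (le_max_left _ _)
  obtain ⟨e⟩ := hle
  exact h.comap e

theorem le_mk_sigma {ι : Type u} {κ : ι → Cardinal.{u}} {c : Cardinal.{u}}
    (h : ∀ d, (∀ i, κ i ≤ d) → c ≤ d) : c ≤ #(Σ i, (κ i).ord.ToType) := by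
  refine h _ fun i => ?_
  rw [mk_sigma]
  exact (mk_ord_toType _).ge.trans (le_sum (fun i => #(κ i).ord.ToType) i)

/-- Singletons give an antichain of `cof |L|` functions. Attaching to its `i`-th member an antichain
of size `2 ^ κ i` yields at least `|L|` incomparable pairs. -/
theorem NuBoundedByMu.cof_le_aleph0 (hν : NuBoundedByMu L) (h : (#L).ord.cof < #L) :
    (#L).ord.cof ≤ ℵ₀ := by
  by_contra! hcof
  obtain ⟨ι, κ, hι, hκ, hsup⟩ := exists_cofinal_cardinals hν.isStrongLimit_mk.isSuccLimit
  have hidx : HasAntichainFamily ((Fin 1 ⊕ Fin 1 → L) × (Fin 1 → L) →o L) ι := by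
    obtain ⟨e⟩ : Nonempty (ι ≃ (#L).ord.cof.ord.ToType) :=
      Cardinal.eq.1 (hι.trans (mk_ord_toType _).symm)
    exact (hν.hasAntichainFamily h).comap ⟨fun i => {e i}, fun i j hij =>
      e.injective (Set.singleton_injective hij)⟩
  have hfam := (hidx.sigma fun i => hν.hasAntichainFamily (hκ i)).select_bool
  have hle : #L ≤ #(Σ i, Set (κ i).ord.ToType) := by
    refine (le_mk_sigma hsup).trans ?_
    rw [mk_sigma, mk_sigma]
    refine Cardinal.sum_le_sum _ _ fun i => ?_
    rw [mk_set]
    exact (cantor _).le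
  have := hν.lt_muInfCard (IsPowerImage.pi.prod (IsPowerImage.pi.prod IsPowerImage.pi)) hfam hcof hle
  exact (hν.muInfCard_eq ▸ this).false

/-- Along the antichain the members of countably many antichains can be chosen independently, so
their sizes multiply to at least `2 ^ |L|`. -/
theorem NuBoundedByMu.not_hasAntichainFamily_nat (hν : NuBoundedByMu L)
    (h : (#L).ord.cof = ℵ₀) {P : Type u} [PartialOrder P] (hP : IsPowerImage L P) :
    ¬ HasAntichainFamily P ℕ := by
  intro hA
  obtain ⟨ι, κ, hι, hκ, hsup⟩ := exists_cofinal_cardinals hν.isStrongLimit_mk.isSuccLimit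
  have : Countable ι := mk_le_aleph0_iff.1 (hι.trans h).le
  obtain ⟨e, he⟩ := exists_injective_nat ι
  obtain ⟨b, hb⟩ := hA.comap ⟨e, he⟩
  have hfam := (HasAntichainFamily.pi fun i => hν.hasAntichainFamily (hκ i)).map
    (selectEmbedding hb)
  have hinf : ℵ₀ ≤ #L := aleph0_le_mk L
  have hle : 2 ^ #L ≤ #(∀ i, Set (κ i).ord.ToType) := by
    have : #(∀ i, Set (κ i).ord.ToType) = #(Set (Σ i, (κ i).ord.ToType)) :=
      mk_congr (Equiv.piCurry fun _ _ => Prop).symm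
    rw [this, mk_set]
    exact power_le_power_left two_ne_zero (le_mk_sigma hsup)
  have := hν.lt_muInfCard (hP.prod (IsPowerImage.pi.prod IsPowerImage.pi)) hfam
    (hinf.trans_lt (lt_cof_ord_power hinf (by simp))) hle
  rw [hν.muInfCard_eq] at this
  exact (cantor _).not_gt this

theorem NuBoundedByMu.exists_regular_sequence (hν : NuBoundedByMu L) (h : (#L).ord.cof = ℵ₀) :
    ∃ μ : ℕ → Cardinal.{u}, (∀ n, (μ n).IsRegular) ∧ (∀ n, ℵ₀ < μ n) ∧ StrictMono μ ∧
      (∀ n, μ n < #L) ∧ ∀ d, (∀ n, μ n ≤ d) → #L ≤ d := by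
  have hlim := hν.isStrongLimit_mk.isSuccLimit
  obtain ⟨ι, κ, hι, hκ, hsup⟩ := exists_cofinal_cardinals hlim
  have hcount : Countable ι := mk_le_aleph0_iff.1 (hι.trans h).le
  have hne : Nonempty ι := mk_ne_zero_iff.1 (by rw [hι, h]; exact aleph0_ne_zero)
  obtain ⟨e, he⟩ := exists_surjective_nat ι
  have h0 : ℵ₀ < #L := hν.muInfCard_eq ▸ aleph0_lt_muInfCard
  -- Successor cardinals are regular, and taking the maximum with the previous term forces strict
  -- growth.
  let μ : ℕ → Cardinal.{u} := fun n => Nat.rec (Order.succ (max ℵ₀ (κ (e 0))))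
    (fun k c => Order.succ (max c (κ (e (k + 1))))) n
  have hsucc : ∀ n, μ (n + 1) = Order.succ (max (μ n) (κ (e (n + 1)))) := fun _ => rfl
  have hzero : μ 0 = Order.succ (max ℵ₀ (κ (e 0))) := rfl
  have hmono : StrictMono μ := strictMono_nat_of_lt_succ fun n => by
    rw [hsucc]
    exact Order.lt_succ_of_le (le_max_left _ _)
  have hunc : ∀ n, ℵ₀ < μ n := fun n => lt_of_lt_of_le
    (by rw [hzero]; exact Order.lt_succ_of_le (le_max_left _ _)) (hmono.monotone (Nat.zero_le n))
  refine ⟨μ, fun n => ?_, hunc, hmono, fun n => ?_, fun d hd => hsup d fun i => ?_⟩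
  · cases n with
    | zero => exact isRegular_succ (le_max_left _ _)
    | succ n => exact isRegular_succ ((hunc n).le.trans (le_max_left _ _))
  · induction n with
    | zero => exact hlim.succ_lt (max_lt h0 (hκ _))
    | succ n ih => exact hlim.succ_lt (max_lt ih (hκ _))
  · obtain ⟨n, rfl⟩ := he i
    refine le_trans ?_ (hd n)
    cases n with
    | zero => exact (le_max_right _ _).trans (Order.le_succ _)
    | succ n => exact (le_max_right _ _).trans (Order.le_succ _)

theorem NuBoundedByMu.isInaccessible (hν : NuBoundedByMu L) : (#L).IsInaccessible := by
  have h0 : ℵ₀ < #L := hν.muInfCard_eq ▸ aleph0_lt_muInfCard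
  refine ⟨h0, le_of_not_gt fun hcof => ?_, hν.isStrongLimit_mk.isStrongPrelimit⟩
  have hω : (#L).ord.cof = ℵ₀ := le_antisymm (hν.cof_le_aleph0 hcof)
    (Ordinal.aleph0_le_cof_iff.2
    (Ordinal.one_lt_cof_iff.2 (isSuccLimit_ord h0.le)))
  obtain ⟨μ, hreg, hunc, hmono, hlt, hsup⟩ := hν.exists_regular_sequence hω
  rcases infinite_antichain_or_wellQuasiOrdered L with h | h | h | h
  · exact hν.not_hasAntichainFamily_nat hω IsPowerImage.self h
  · exact hν.not_hasAntichainFamily_nat hω (IsPowerImage.self.prod IsPowerImage.self) h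
  · exact hν.not_hasUniform
      (HasUniform.of_wellQuasiOrdered hreg hunc hmono (fun n => hν.hasUniform (hlt n)) hsup)
  · exact hν.not_hasUniform (HasUniform.ofDual (HasUniform.of_wellQuasiOrdered hreg hunc hmono
      (fun n => HasUniform.ofDual (L := Lᵒᵈ) (hν.hasUniform (hlt n))) hsup))

end Main

/-! ### Shapes and constants of lattice polynomials. -/

namespace LatticePolynomial

/-- Substitute constants. -/
def mapConst {C D : Type*} {n : ℕ} (g : C → D) : LatticePolynomial C n → LatticePolynomial D n
  | var i => var i
  | const a => const (g a)
  | sup p q => sup (p.mapConst g) (q.mapConst g)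
  | inf p q => inf (p.mapConst g) (q.mapConst g)

theorem mapConst_mapConst {C D E : Type*} {n : ℕ} (g : C → D) (h : D → E)
    (p : LatticePolynomial C n) : (p.mapConst g).mapConst h = p.mapConst (h ∘ g) := by
  induction p with
  | var i => rfl
  | const a => rfl
  | sup p q hp hq => simp only [mapConst, hp, hq]
  | inf p q hp hq => simp only [mapConst, hp, hq]

/-- Every lattice polynomial is obtained from one whose constants are finitely many parameters. -/
theorem exists_mapConst_fin {L : Type*} {n : ℕ} (p : LatticePolynomial L n) :
    ∃ (k : ℕ) (q : LatticePolynomial (Fin k) n) (a : Fin k → L), p = q.mapConst a := by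
  have key : ∀ {k l : ℕ} (q : LatticePolynomial (Fin k) n) (r : LatticePolynomial (Fin l) n)
      (a : Fin k → L) (b : Fin l → L),
      (q.mapConst (Fin.castAdd l)).mapConst (Fin.append a b) = q.mapConst a ∧
      (r.mapConst (Fin.natAdd k)).mapConst (Fin.append a b) = r.mapConst b := by
    intro k l q r a b
    rw [mapConst_mapConst, mapConst_mapConst]
    constructor <;> congr 1 <;> ext i <;> simp
  induction p with
  | var i => exact ⟨0, var i, Fin.elim0, rfl⟩
  | const a => exact ⟨1, const 0, fun _ => a, rfl⟩
  | sup p q hp hq =>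
    obtain ⟨k, r, a, rfl⟩ := hp
    obtain ⟨l, s, b, rfl⟩ := hq
    obtain ⟨h1, h2⟩ := key r s a b
    exact ⟨k + l, sup (r.mapConst (Fin.castAdd l)) (s.mapConst (Fin.natAdd k)), Fin.append a b,
      by rw [mapConst, h1, h2]⟩
  | inf p q hp hq =>
    obtain ⟨k, r, a, rfl⟩ := hp
    obtain ⟨l, s, b, rfl⟩ := hq
    obtain ⟨h1, h2⟩ := key r s a b
    exact ⟨k + l, inf (r.mapConst (Fin.castAdd l)) (s.mapConst (Fin.natAdd k)), Fin.append a b,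
      by rw [mapConst, h1, h2]⟩

/-- The polynomials of depth at most `d`. -/
def ofDepth (C : Type*) (n : ℕ) : ℕ → Set (LatticePolynomial C n)
  | 0 => Set.range var ∪ Set.range const
  | d + 1 => ofDepth C n d ∪ (Set.image2 sup (ofDepth C n d) (ofDepth C n d) ∪
      Set.image2 inf (ofDepth C n d) (ofDepth C n d))

theorem ofDepth_countable (C : Type*) [Countable C] (n d : ℕ) : (ofDepth C n d).Countable := by
  induction d with
  | zero => exact (Set.countable_range _).union (Set.countable_range _)
  | succ d ih => exact ih.union ((ih.image2 ih _).union (ih.image2 ih _))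

theorem ofDepth_mono (C : Type*) (n : ℕ) : Monotone (ofDepth C n) :=
  monotone_nat_of_le_succ fun _ => Set.subset_union_left

theorem exists_mem_ofDepth {C : Type*} {n : ℕ} (p : LatticePolynomial C n) :
    ∃ d, p ∈ ofDepth C n d := by
  induction p with
  | var i => exact ⟨0, Or.inl ⟨i, rfl⟩⟩
  | const a => exact ⟨0, Or.inr ⟨a, rfl⟩⟩
  | sup p q hp hq =>
    obtain ⟨d, hd⟩ := hp
    obtain ⟨e, he⟩ := hq
    exact ⟨max d e + 1, Or.inr (Or.inl ⟨p, ofDepth_mono C n (le_max_left d e) hd, q,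
      ofDepth_mono C n (le_max_right d e) he, rfl⟩)⟩
  | inf p q hp hq =>
    obtain ⟨d, hd⟩ := hp
    obtain ⟨e, he⟩ := hq
    exact ⟨max d e + 1, Or.inr (Or.inr ⟨p, ofDepth_mono C n (le_max_left d e) hd, q,
      ofDepth_mono C n (le_max_right d e) he, rfl⟩)⟩

instance {C : Type*} [Countable C] {n : ℕ} : Countable (LatticePolynomial C n) :=
  Set.countable_univ_iff.1 ((Set.countable_iUnion (ofDepth_countable C n)).mono fun p _ =>
    Set.mem_iUnion.2 (exists_mem_ofDepth p))

section Lattice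

variable {L : Type u} [Lattice L] {n : ℕ}

theorem eval_mapConst_mono {C : Type*} (q : LatticePolynomial C n) {a b : C → L} (h : a ≤ b)
    (x : Fin n → L) : (q.mapConst a).eval x ≤ (q.mapConst b).eval x := by
  induction q with
  | var i => exact le_rfl
  | const c => exact h c
  | sup p q hp hq => exact sup_le_sup hp hq
  | inf p q hp hq => exact inf_le_inf hp hq

/-- At `x = c` this gives `p c ≤ c`, so no unary polynomial function satisfies `f x ≰ x` everywhere.
-/
theorem exists_eval_le [Nonempty L] (p : LatticePolynomial L 1) :
    ∃ c, ∀ x : Fin 1 → L, p.eval x ≤ x 0 ⊔ c := by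
  induction p with
  | var i =>
    exact ⟨Classical.arbitrary L, fun x => by rw [Subsingleton.elim i 0]; exact le_sup_left⟩
  | const a => exact ⟨a, fun x => le_sup_right⟩
  | sup p q hp hq =>
    obtain ⟨c, hc⟩ := hp
    obtain ⟨d, hd⟩ := hq
    refine ⟨c ⊔ d, fun x => sup_le ((hc x).trans ?_) ((hd x).trans ?_)⟩
    · exact sup_le_sup_left le_sup_left _
    · exact sup_le_sup_left le_sup_right _
  | inf p q hp hq =>
    obtain ⟨c, hc⟩ := hp
    exact ⟨c, fun x => inf_le_left.trans (hc x)⟩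

/-- The polynomial on the dual lattice with joins and meets exchanged. -/
def swap : LatticePolynomial L n → LatticePolynomial Lᵒᵈ n
  | var i => var i
  | const a => const (OrderDual.toDual a)
  | sup p q => inf p.swap q.swap
  | inf p q => sup p.swap q.swap

theorem eval_swap (p : LatticePolynomial L n) (x : Fin n → Lᵒᵈ) :
    p.swap.eval x = OrderDual.toDual (p.eval fun i => OrderDual.ofDual (x i)) := by
  induction p with
  | var i => rfl
  | const a => rfl
  | sup p q hp hq => rw [swap, eval, eval, hp, hq, toDual_sup]
  | inf p q hp hq => rw [swap, eval, eval, hp, hq, toDual_inf]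

end Lattice

end LatticePolynomial

/-! ### Order polynomially complete lattices satisfy the hypotheses of part 2. -/

theorem IsNOrderPolynomiallyComplete.dual {L : Type u} [Lattice L] {n : ℕ}
    (h : IsNOrderPolynomiallyComplete n L) : IsNOrderPolynomiallyComplete n Lᵒᵈ := by
  intro f hf
  obtain ⟨p, hp⟩ := h (fun x => OrderDual.ofDual (f fun i => OrderDual.toDual (x i)))
    fun x y hxy => hf (a := fun i => OrderDual.toDual (y i)) (b := fun i => OrderDual.toDual (x i)) hxy
  exact ⟨p.swap, fun x => by rw [p.eval_swap, ← hp]; rfl⟩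

/-- A chain without upper bound yields a monotone function `f` with `f x ≰ x` for all `x`. -/
theorem IsChain.exists_monotone_not_le {L : Type u} [PartialOrder L] {M : Set L}
    (hM : IsChain (· ≤ ·) M) (hub : ∀ x, ∃ m ∈ M, ¬ m ≤ x) :
    ∃ f : L → L, Monotone f ∧ ∀ x, ¬ f x ≤ x := by
  have hwf : WellFounded (WellOrderingRel : L → L → Prop) := IsWellFounded.wf
  have hne : ∀ x, {m | m ∈ M ∧ ¬ m ≤ x}.Nonempty := hub
  refine ⟨fun x => hwf.min _ (hne x), fun x y hxy => ?_, fun x => (hwf.min_mem _ (hne x)).2⟩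
  have hx := hwf.min_mem _ (hne x)
  have hy := hwf.min_mem _ (hne y)
  -- The value at `x` is the first element of `M`, in an arbitrary well-ordering, that is not below
  -- `x`. If the value at `x` comes earlier than that at `y`, it lies below `y`, so the chain forces
  -- it below the value at `y`. It cannot come later.
  rcases trichotomous_of WellOrderingRel (hwf.min _ (hne x)) (hwf.min _ (hne y)) with h | h | h
  · have hxy' : hwf.min _ (hne x) ≤ y := by
      by_contra hcon
      exact hwf.not_lt_min _ (show _ ∈ {m | m ∈ M ∧ ¬ m ≤ y} from ⟨hx.1, hcon⟩) h
    rcases hM.total hx.1 hy.1 with h' | h'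
    · exact h'
    · exact absurd (h'.trans hxy') hy.2
  · exact h.le
  · exact absurd h (hwf.not_lt_min _ (show _ ∈ {m | m ∈ M ∧ ¬ m ≤ x} from
      ⟨hy.1, fun hle => hy.2 (hle.trans hxy)⟩))

/-- Without a top element a maximal chain has no upper bound, since an upper bound `x` could be
enlarged to `x ⊔ z`. The resulting `f` is then not polynomial. -/
theorem exists_isTop_of_opc {L : Type u} [Lattice L] [Nonempty L]
    (h : IsNOrderPolynomiallyComplete 1 L) : ∃ t : L, ∀ x, x ≤ t := by
  by_contra! hno
  obtain ⟨f, hf, hfx⟩ := (maxChain_spec (r := ((· ≤ ·) : L → L → Prop))).1.exists_monotone_not_le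
    (fun x => by
      by_contra! hx
      obtain ⟨z, hz⟩ := hno x
      have hlt : x < x ⊔ z := lt_of_le_not_ge le_sup_left fun hle => hz (le_sup_right.trans hle)
      have hmem : x ⊔ z ∈ maxChain ((· ≤ ·) : L → L → Prop) := by
        have := (maxChain_spec (r := ((· ≤ ·) : L → L → Prop))).2
          ((maxChain_spec (r := ((· ≤ ·) : L → L → Prop))).1.insert (a := x ⊔ z)
            fun b hb _ => Or.inr ((hx b hb).trans le_sup_left)) (Set.subset_insert _ _)
        rw [this]
        exact Set.mem_insert _ _
      exact (hx _ hmem).not_gt hlt)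
  obtain ⟨p, hp⟩ := h (fun x => f (x 0)) fun x y hxy => hf (hxy 0)
  obtain ⟨c, hc⟩ := p.exists_eval_le
  have := hc fun _ => c
  rw [← hp, sup_idem] at this
  exact hfx c this

theorem IsOrderPolynomiallyComplete.exists_boundedOrder {L : Type u} [Lattice L] [Nonempty L]
    (h : IsOrderPolynomiallyComplete L) : Nonempty (BoundedOrder L) := by
  obtain ⟨t, ht⟩ := exists_isTop_of_opc (h 1)
  obtain ⟨b, hb⟩ := exists_isTop_of_opc (L := Lᵒᵈ) (h 1).dual
  exact ⟨{ top := t, le_top := ht, bot := OrderDual.ofDual b, bot_le := fun x => hb (OrderDual.toDual x) }⟩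

theorem IsOrderPolynomiallyComplete.nuBoundedByMu {L : Type u} [Lattice L]
    (h : IsOrderPolynomiallyComplete L) : NuBoundedByMu L := by
  intro n κ hκ hlt
  obtain ⟨F, hF, rfl⟩ := not_not.1 (notMem_of_lt_csInf' hlt)
  have hinf : ℵ₀ < #F := hκ.trans_le (Ordinal.cof_ord_le _)
  have hpoly : ∀ f : F, ∃ (s : Σ k, LatticePolynomial (Fin k) (n + 1)) (a : Fin s.1 → L),
      ∀ x, f.1 x = (s.2.mapConst a).eval x := by
    intro f
    obtain ⟨p, hp⟩ := h (n + 1) f.1 f.1.monotone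
    obtain ⟨k, q, a, rfl⟩ := p.exists_mapConst_fin
    exact ⟨⟨k, q⟩, a, hp⟩
  choose s a ha using hpoly
  -- There are countably many shapes and `κ` has uncountable cofinality, so `κ` functions share one
  -- shape.
  obtain ⟨⟨k, q⟩, hs⟩ := infinite_pigeonhole (fun f => ULift.up.{u} (s f)) hinf.le
    (mk_le_aleph0.trans_lt hκ)
  set T := (fun f => ULift.up.{u} (s f)) ⁻¹' {⟨⟨k, q⟩⟩}
  have hT : ∀ f : T, ∃ b : Fin k → L, ∀ x, f.1.1 x = (q.mapConst b).eval x := by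
    rintro ⟨f, hf⟩
    have hf' : s f = ⟨k, q⟩ := congrArg ULift.down hf
    have := ha f
    generalize s f = r, a f = b at hf' this
    subst hf'
    exact ⟨b, this⟩
  choose b hb using hT
  have hanti : HasAntichainFamily (Fin k → L) T := by
    refine ⟨b, fun f g hfg => Subtype.ext (Subtype.ext ?_)⟩
    refine hF.eq f.1.2 g.1.2 fun x => ?_
    change f.1.1 x ≤ g.1.1 x
    rw [hb f, hb g]
    exact LatticePolynomial.eval_mapConst_mono q hfg x
  obtain ⟨A, hA, hcard⟩ := hanti.exists_set
  -- A shape without constants induces a single function, too few for an uncountable antichain.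
  cases k with
  | zero =>
    have h1 : #A ≤ 1 := (mk_set_le A).trans (le_one_iff_subsingleton.2 inferInstance)
    rw [hcard, hs] at h1
    exact absurd (h1.trans_lt one_lt_aleph0) hinf.not_gt
  | succ k => exact lt_muInfCard_iff.2 ⟨k, A, Or.inl hA, hcard.trans hs⟩

theorem IsOrderPolynomiallyComplete.isInaccessible {L : Type u} [Lattice L] [Infinite L]
    (h : IsOrderPolynomiallyComplete L) : muCard L = #L ∧ (#L).IsInaccessible := by
  obtain ⟨hb⟩ := h.exists_boundedOrder
  exact ⟨h.nuBoundedByMu.muCard_eq, h.nuBoundedByMu.isInaccessible⟩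

theorem mainTheorem1 :
    (∀ (L : Type u) [Lattice L] [Infinite L], IsOrderPolynomiallyComplete L →
      muCard L = #L ∧ (#L).IsInaccessible) ∧
    (∀ (L : Type u) [PartialOrder L] [BoundedOrder L] [Infinite L], NuBoundedByMu L →
      muCard L = #L ∧ (#L).IsInaccessible) ∧
    ((¬ ∃ κ : Cardinal.{u}, κ.IsInaccessible) →
      ¬ ∃ (L : Type u) (_ : Lattice L), Infinite L ∧ IsOrderPolynomiallyComplete L) := by
  refine ⟨fun L _ _ h => h.isInaccessible, fun L _ _ _ hν => ⟨hν.muCard_eq, hν.isInaccessible⟩, ?_⟩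
  rintro hno ⟨L, _, _, h⟩
  exact hno ⟨#L, h.isInaccessible.2⟩
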